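/- Let $X$ be a complex Banach space, let $k\ge 1$ be an integer, $n=2k$, and let $K\subset\mathbb R^n$ be compact. Let $F:\mathbb R^n\to X$ be (Bochner) integrable and $k$-times continuously differentiable. For $R\ge 1$ and $x\in\mathbb R^n$ put $$\hat F(\xi)=\int_{\mathbb R^n}e^{-i\xi\cdot s}F(s)\,ds,\qquad S_R(F)(x)=\frac1{(2\pi)^n}\int_{|\xi|\le R}e^{ix\cdot \xi}\hat F(\xi)\,d\xi .$$ Assume that there are a real-valued $g\in L^1(\mathbb R^n)$ and $\delta>0$ such that $$\sup_{\alpha\in\mathbb N_0^n,\ |\alpha|\le k}\ \sup_{x\in K}\ |y|^{-n+k}\,\bigl\|\nabla^\alpha F(x+y)\bigr\|\le g(y)\qquad\text{for all } y\in\mathbb R^n \text{ with } |y|\ge\delta ,$$ where $\nabla^\alpha F=\partial_1^{\alpha_1}\cdots\partial_n^{\alpha_n}F$ and $|\cdot|$ is the Euclidean norm on $\mathbb R^n$. Then $S_R(F)\to F$ as $R\to\infty$ uniformly on $K$, that is, $$\lim_{R\to\infty}\ \sup_{x\in K}\ \|S_R(F)(x)-F(x)\|=0 .$$ -/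

import Mathlib

open MeasureTheory Filter

noncomputable section

variable {n : ℕ} {X : Type*} [NormedAddCommGroup X] [NormedSpace ℂ X]

/-- The Fourier transform `k ↦ ∫ e^{-i k·s} F(s) ds` on `ℝⁿ`, for vector-valued `F`
(angular frequency convention, without a normalising factor). -/
def angularFourier (F : EuclideanSpace ℝ (Fin n) → X) (k : EuclideanSpace ℝ (Fin n)) : X :=
  ∫ s, Complex.exp (-(Complex.I * ((inner ℝ k s : ℝ) : ℂ))) • F s

/-- The spherical partial Fourier inversion integral
`S_R(F)(x) = (2π)^{-n} ∫_{|k| ≤ R} e^{i x·k} F̂(k) dk`. -/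
def fourierPartialInversion (R : ℝ) (F : EuclideanSpace ℝ (Fin n) → X)
    (x : EuclideanSpace ℝ (Fin n)) : X :=
  ((1 : ℂ) / (2 * (Real.pi : ℂ)) ^ n) •
    ∫ k in Metric.closedBall (0 : EuclideanSpace ℝ (Fin n)) R,
      Complex.exp (Complex.I * ((inner ℝ x k : ℝ) : ℂ)) • angularFourier F k

/-- The partial derivative `∇^α F(x) = ∂₁^{α₁} ⋯ ∂ₙ^{αₙ} F(x)` for a multi-index `α`: the
derivative of order `|α| = α₁ + ⋯ + αₙ` of `F` at `x`, evaluated at the list of standard basis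
vectors in which `e₁` occurs `α₁` times, then `e₂` occurs `α₂` times, and so on. -/
def multiPartialDeriv (α : Fin n → ℕ) (F : EuclideanSpace ℝ (Fin n) → X)
    (x : EuclideanSpace ℝ (Fin n)) : X :=
  iteratedFDeriv ℝ (∑ i, α i) F x
    (fun j => EuclideanSpace.single (finSigmaFinEquiv.symm j).1 (1 : ℝ))

end

/-!
The partial inversion `S_R` is convolution with the radial spherical Dirichlet kernel, so in polar
coordinates `S_R F(x)` is an average over unit vectors `ω` of the one-dimensional integrals
`∫₀^∞ R^n r^(n-1) P_n(R r) F(x + r ω) dr`, where `P_n(r) = ∫₀^π e^{i r cos θ} sin^n θ dθ` is a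
multiple of `r^{-n/2} J_{n/2}(r)`. Since `P_n'(r) = -(r / (n + 1)) P_{n+2}(r)`, integrating by parts
lowers the dimension by two at the cost of one derivative of `F` along the ray. As `n = 2k` is even,
`k - 1` such steps lead to dimension two, where one further integration by parts gives a boundary
term proportional to `F(x)` and an error of size at most `∫₀^∞ |P_0(R r)| |v'(r)| dr`, with `v`
built from the derivatives of `F` of order less than `k` along the ray. The boundary terms average
to exactly `F(x)`. The hypothesis, together with the boundedness of the derivatives near `K`,
dominates the errors uniformly in `x ∈ K` by a single integrable function; as `P_0(r) → 0` when
`r → ∞` by the Riemann–Lebesgue lemma, dominated convergence finishes the proof.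
-/

open scoped Real Topology

section PhaseIntegral

-- If `f` is not integrable on `s`, all the integrals have the junk value `0`.
theorem tendsto_setIntegral_cexp_phase_smul {E : Type*} [NormedAddCommGroup E] [NormedSpace ℂ E]
    {s : Set ℝ} (hs : MeasurableSet s) {ψ ψ' : ℝ → ℝ} (hinj : Set.InjOn ψ s)
    (hψ : ∀ x ∈ s, HasDerivWithinAt ψ (ψ' x) s x) (hψ' : ∀ x ∈ s, ψ' x ≠ 0) (f : ℝ → E) :
    Tendsto (fun r : ℝ => ∫ x in s, Complex.exp (Complex.I * (r * ψ x : ℝ)) • f x)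
      atTop (𝓝 0) := by
  let g : ℝ → E := (ψ '' s).indicator fun t =>
    |ψ' (Function.invFunOn ψ s t)|⁻¹ • f (Function.invFunOn ψ s t)
  have himage : MeasurableSet (ψ '' s) :=
    hs.image_of_continuousOn_injOn (fun x hx => (hψ x hx).continuousWithinAt) hinj
  have hchar : ∀ r t : ℝ, (Real.fourierChar (-(t * -(r / (2 * π)))) : ℂ) =
      Complex.exp (Complex.I * (r * t : ℝ)) := by
    intro r t
    rw [Real.fourierChar_apply, mul_comm]
    congr 3
    field_simp
  have hsubst : ∀ r : ℝ, ∫ x in s, Complex.exp (Complex.I * (r * ψ x : ℝ)) • f x =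
      ∫ t, Real.fourierChar (-(t * -(r / (2 * π)))) • g t := by
    intro r
    have hindicator : ∀ t, Real.fourierChar (-(t * -(r / (2 * π)))) • g t =
        (ψ '' s).indicator (fun t => Complex.exp (Complex.I * (r * t : ℝ)) • g t) t := by
      intro t
      by_cases ht : t ∈ ψ '' s
      · rw [Set.indicator_of_mem ht, Circle.smul_def, hchar]
      · simp only [g, Set.indicator_of_notMem ht, smul_zero]
    simp_rw [hindicator]
    rw [integral_indicator himage, integral_image_eq_integral_abs_deriv_smul hs hψ hinj]
    refine setIntegral_congr_fun hs fun x hx => ?_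
    have hinv : Function.invFunOn ψ s (ψ x) = x := hinj.leftInvOn_invFunOn hx
    simp only [g, Set.indicator_of_mem (Set.mem_image_of_mem ψ hx), hinv]
    rw [smul_comm, smul_inv_smul₀ (abs_ne_zero.2 (hψ' x hx))]
  simp_rw [hsubst]
  refine (Real.tendsto_integral_exp_smul_cocompact g).comp ?_
  exact (tendsto_neg_atTop_atBot.comp (tendsto_id.atTop_div_const Real.two_pi_pos)).mono_right
    atBot_le_cocompact

/-- The oscillatory integral `∫_0^π e^{i r cos θ} w(θ) dθ` with weight `w`. -/
noncomputable def cosPhaseIntegral (w : ℝ → ℝ) (r : ℝ) : ℂ :=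
  ∫ θ in (0 : ℝ)..π, Complex.exp (Complex.I * (r * Real.cos θ : ℝ)) * (w θ : ℂ)

variable {w : ℝ → ℝ}

theorem norm_cosPhaseIntegral_le {C : ℝ} (hw : ∀ θ, |w θ| ≤ C) (r : ℝ) :
    ‖cosPhaseIntegral w r‖ ≤ C * π := by
  have hbound : ∀ θ ∈ Set.uIoc 0 π,
      ‖Complex.exp (Complex.I * (r * Real.cos θ : ℝ)) * (w θ : ℂ)‖ ≤ C := fun θ _ => by
    rw [norm_mul, Complex.norm_exp_I_mul_ofReal, one_mul, Complex.norm_real]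
    exact hw θ
  simpa [cosPhaseIntegral, abs_of_pos Real.pi_pos] using
    intervalIntegral.norm_integral_le_of_norm_le_const hbound

theorem cosPhaseIntegral_const_mul (c : ℝ) (w : ℝ → ℝ) (r : ℝ) :
    cosPhaseIntegral (fun θ => c * w θ) r = c * cosPhaseIntegral w r := by
  rw [cosPhaseIntegral, cosPhaseIntegral, ← intervalIntegral.integral_const_mul]
  congr 1 with θ
  push_cast
  ring

theorem cosPhaseIntegral_sub {v : ℝ → ℝ} (hv : Continuous v) (hw : Continuous w) (r : ℝ) :
    cosPhaseIntegral (fun θ => v θ - w θ) r = cosPhaseIntegral v r - cosPhaseIntegral w r := by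
  rw [cosPhaseIntegral, cosPhaseIntegral, cosPhaseIntegral, ← intervalIntegral.integral_sub
    (Continuous.intervalIntegrable (by fun_prop) _ _)
    (Continuous.intervalIntegrable (by fun_prop) _ _)]
  congr 1 with θ
  push_cast
  ring

theorem cosPhaseIntegral_deriv {w' : ℝ → ℝ} (hw : ∀ θ, HasDerivAt w (w' θ) θ)
    (hw' : Continuous w') (h0 : w 0 = 0) (hπ : w π = 0) (r : ℝ) :
    cosPhaseIntegral w' r =
      Complex.I * r * cosPhaseIntegral (fun θ => Real.sin θ * w θ) r := by
  have hphase : ∀ θ : ℝ, HasDerivAt (fun θ : ℝ => Complex.exp (Complex.I * (r * Real.cos θ : ℝ)))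
      (-(Complex.I * r * Real.sin θ) * Complex.exp (Complex.I * (r * Real.cos θ : ℝ))) θ := by
    intro θ
    convert ((((Real.hasDerivAt_cos θ).const_mul r).ofReal_comp).const_mul Complex.I).cexp using 1
    push_cast
    ring
  rw [cosPhaseIntegral, intervalIntegral.integral_mul_deriv_eq_deriv_mul
    (v := fun θ => ((w θ : ℝ) : ℂ)) (fun θ _ => hphase θ) (fun θ _ => (hw θ).ofReal_comp)
    (Continuous.intervalIntegrable (by fun_prop) _ _)
    (Continuous.intervalIntegrable (by fun_prop) _ _)]
  simp only [h0, hπ, Complex.ofReal_zero, mul_zero, sub_zero, zero_sub]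
  rw [← intervalIntegral.integral_neg, cosPhaseIntegral, ← intervalIntegral.integral_const_mul]
  congr 1 with θ
  push_cast
  ring

theorem hasDerivAt_cosPhaseIntegral (hw : Continuous w) (r : ℝ) :
    HasDerivAt (cosPhaseIntegral w)
      (Complex.I * cosPhaseIntegral (fun θ => Real.cos θ * w θ) r) r := by
  have hderiv : ∀ r θ : ℝ, HasDerivAt
      (fun r : ℝ => Complex.exp (Complex.I * (r * Real.cos θ : ℝ)) * (w θ : ℂ))
      (Complex.I * (Complex.exp (Complex.I * (r * Real.cos θ : ℝ)) *
        ((Real.cos θ * w θ : ℝ) : ℂ))) r := by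
    intro r θ
    refine ((((hasDerivAt_id r).mul_const (Real.cos θ)).ofReal_comp).const_mul
      Complex.I).cexp.mul_const (w θ : ℂ) |>.congr_deriv ?_
    simp only [id]
    push_cast
    ring
  have hbound : ∀ r θ : ℝ, ‖Complex.I * (Complex.exp (Complex.I * (r * Real.cos θ : ℝ)) *
      ((Real.cos θ * w θ : ℝ) : ℂ))‖ ≤ |w θ| := by
    intro r θ
    rw [norm_mul, norm_mul, Complex.norm_exp_I_mul_ofReal, Complex.norm_I, one_mul, one_mul,
      Complex.norm_real, norm_mul, Real.norm_eq_abs, Real.norm_eq_abs]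
    exact mul_le_of_le_one_left (abs_nonneg _) (Real.abs_cos_le_one θ)
  have h := intervalIntegral.hasDerivAt_integral_of_dominated_loc_of_deriv_le (μ := volume)
    (a := 0) (b := π) (x₀ := r) (s := Set.univ) univ_mem
    (Eventually.of_forall fun r => Continuous.aestronglyMeasurable (by fun_prop))
    (Continuous.intervalIntegrable (by fun_prop) _ _)
    (Continuous.aestronglyMeasurable (by fun_prop))
    (Eventually.of_forall fun θ _ r _ => hbound r θ)
    (Continuous.intervalIntegrable (by fun_prop) _ _)
    (Eventually.of_forall fun θ _ r _ => hderiv r θ)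
  exact h.2.congr_deriv (intervalIntegral.integral_const_mul _ _)

theorem tendsto_cosPhaseIntegral_atTop (w : ℝ → ℝ) :
    Tendsto (cosPhaseIntegral w) atTop (𝓝 0) := by
  have h := tendsto_setIntegral_cexp_phase_smul (s := Set.Ioo 0 π) measurableSet_Ioo
    (Real.injOn_cos.mono Set.Ioo_subset_Icc_self)
    (fun θ _ => (Real.hasDerivAt_cos θ).hasDerivWithinAt)
    (fun θ hθ => neg_ne_zero.2 (Real.sin_pos_of_mem_Ioo hθ).ne') (fun θ => (w θ : ℂ))
  refine h.congr fun r => ?_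
  rw [cosPhaseIntegral, intervalIntegral.integral_of_le Real.pi_pos.le,
    integral_Ioc_eq_integral_Ioo]
  simp only [smul_eq_mul]

end PhaseIntegral

section Bessel

/-- Poisson's integral `∫_0^π e^{i r cos θ} sin^p θ dθ`, which is `r^{-p/2} J_{p/2}(r)` up to a
constant factor. -/
noncomputable def besselIntegral (p : ℕ) : ℝ → ℂ :=
  cosPhaseIntegral fun θ => Real.sin θ ^ p

/-- The companion `∫_0^π e^{i r cos θ} cos θ sin^p θ dθ` of `besselIntegral p`, equal to `-i` times
its derivative. -/
noncomputable def besselCosIntegral (p : ℕ) : ℝ → ℂ :=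
  cosPhaseIntegral fun θ => Real.cos θ * Real.sin θ ^ p

theorem norm_besselIntegral_le (p : ℕ) (r : ℝ) : ‖besselIntegral p r‖ ≤ π := by
  refine (norm_cosPhaseIntegral_le (C := 1) (fun θ => ?_) r).trans_eq (one_mul π)
  rw [abs_pow]
  exact pow_le_one₀ (abs_nonneg _) (Real.abs_sin_le_one θ)

theorem norm_besselCosIntegral_le (p : ℕ) (r : ℝ) : ‖besselCosIntegral p r‖ ≤ π := by
  refine (norm_cosPhaseIntegral_le (C := 1) (fun θ => ?_) r).trans_eq (one_mul π)
  rw [abs_mul, abs_pow]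
  exact mul_le_one₀ (Real.abs_cos_le_one θ) (by positivity)
    (pow_le_one₀ (abs_nonneg _) (Real.abs_sin_le_one θ))

theorem mul_besselIntegral_add_two (p : ℕ) (r : ℝ) :
    Complex.I * r * besselIntegral (p + 2) r = (p + 1) * besselCosIntegral p r := by
  have hderiv : ∀ θ, HasDerivAt (fun θ => Real.sin θ ^ (p + 1))
      (((p + 1 : ℕ) : ℝ) * (Real.cos θ * Real.sin θ ^ p)) θ := fun θ =>
    ((Real.hasDerivAt_sin θ).fun_pow (p + 1)).congr_deriv (by rw [Nat.add_sub_cancel]; ring)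
  have hparts := cosPhaseIntegral_deriv hderiv (by fun_prop) (by simp) (by simp) r
  rw [cosPhaseIntegral_const_mul] at hparts
  simp only [← pow_succ'] at hparts
  simpa [besselIntegral, besselCosIntegral] using hparts.symm

theorem mul_besselCosIntegral_add_two (p : ℕ) (r : ℝ) :
    Complex.I * r * besselCosIntegral (p + 2) r =
      (p + 1) * besselIntegral p r - (p + 2) * besselIntegral (p + 2) r := by
  have hderiv : ∀ θ, HasDerivAt (fun θ => Real.cos θ * Real.sin θ ^ (p + 1))
      (((p + 1 : ℕ) : ℝ) * Real.sin θ ^ p - ((p + 2 : ℕ) : ℝ) * Real.sin θ ^ (p + 2)) θ := by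
    intro θ
    refine ((Real.hasDerivAt_cos θ).fun_mul
      ((Real.hasDerivAt_sin θ).fun_pow (p + 1))).congr_deriv ?_
    rw [Nat.add_sub_cancel]
    push_cast
    linear_combination ((p : ℝ) + 1) * Real.sin θ ^ p * Real.cos_sq' θ
  have hparts := cosPhaseIntegral_deriv hderiv (by fun_prop) (by simp) (by simp) r
  rw [cosPhaseIntegral_sub (by fun_prop) (by fun_prop), cosPhaseIntegral_const_mul,
    cosPhaseIntegral_const_mul] at hparts
  have hweight : (fun θ => Real.sin θ * (Real.cos θ * Real.sin θ ^ (p + 1))) =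
      fun θ => Real.cos θ * Real.sin θ ^ (p + 2) := by
    ext θ
    ring
  rw [hweight] at hparts
  simpa [besselIntegral, besselCosIntegral] using hparts.symm

theorem hasDerivAt_besselIntegral (p : ℕ) (r : ℝ) :
    HasDerivAt (besselIntegral p) (-(r / (p + 1) : ℝ) * besselIntegral (p + 2) r) r := by
  refine (hasDerivAt_cosPhaseIntegral (by fun_prop) r).congr_deriv ?_
  change Complex.I * besselCosIntegral p r = _
  have hp : (p + 1 : ℂ) ≠ 0 := p.cast_add_one_ne_zero
  push_cast
  field_simp
  linear_combination (-Complex.I) * mul_besselIntegral_add_two p r +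
    r * besselIntegral (p + 2) r * Complex.I_sq

theorem continuous_besselIntegral (p : ℕ) : Continuous (besselIntegral p) :=
  continuous_iff_continuousAt.2 fun r => (hasDerivAt_besselIntegral p r).continuousAt

theorem exists_pow_mul_norm_besselIntegral_le {j p : ℕ} (h : 2 * j ≤ p) :
    ∃ C, ∀ r, |r| ^ j * ‖besselIntegral p r‖ ≤ C ∧ |r| ^ j * ‖besselCosIntegral p r‖ ≤ C := by
  induction j generalizing p with
  | zero =>
    exact ⟨π, fun r => by simpa using ⟨norm_besselIntegral_le p r, norm_besselCosIntegral_le p r⟩⟩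
  | succ j ih =>
    obtain ⟨q, rfl⟩ : ∃ q, p = q + 2 := ⟨p - 2, by omega⟩
    obtain ⟨C, hC⟩ := ih (p := q) (by omega)
    obtain ⟨D, hD⟩ := ih (p := q + 2) (by omega)
    have hcast₁ : ‖(q + 1 : ℂ)‖ = q + 1 := mod_cast Complex.norm_natCast (q + 1)
    have hcast₂ : ‖(q + 2 : ℂ)‖ = q + 2 := mod_cast Complex.norm_natCast (q + 2)
    refine ⟨(q + 1) * C + (q + 2) * D, fun r => ?_⟩
    obtain ⟨hPC, hQC⟩ := hC r
    obtain ⟨hPD, -⟩ := hD r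
    have hD0 : 0 ≤ D := le_trans (by positivity) hPD
    have hrec₁ : |r| * ‖besselIntegral (q + 2) r‖ = (q + 1) * ‖besselCosIntegral q r‖ := by
      simpa [hcast₁] using congrArg norm (mul_besselIntegral_add_two q r)
    have hrec₂ : |r| * ‖besselCosIntegral (q + 2) r‖ ≤
        (q + 1) * ‖besselIntegral q r‖ + (q + 2) * ‖besselIntegral (q + 2) r‖ := by
      have hnorm := congrArg norm (mul_besselCosIntegral_add_two q r)
      simp only [norm_mul, Complex.norm_I, one_mul, Complex.norm_real, Real.norm_eq_abs] at hnorm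
      rw [hnorm]
      refine (norm_sub_le _ _).trans_eq ?_
      rw [norm_mul, norm_mul, hcast₁, hcast₂]
    constructor
    · calc |r| ^ (j + 1) * ‖besselIntegral (q + 2) r‖
          = |r| ^ j * (|r| * ‖besselIntegral (q + 2) r‖) := by ring
        _ = (q + 1) * (|r| ^ j * ‖besselCosIntegral q r‖) := by rw [hrec₁]; ring
        _ ≤ (q + 1) * C := by gcongr
        _ ≤ (q + 1) * C + (q + 2) * D := le_add_of_nonneg_right (by positivity)
    · calc |r| ^ (j + 1) * ‖besselCosIntegral (q + 2) r‖
          = |r| ^ j * (|r| * ‖besselCosIntegral (q + 2) r‖) := by ring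
        _ ≤ |r| ^ j * ((q + 1) * ‖besselIntegral q r‖ + (q + 2) * ‖besselIntegral (q + 2) r‖) := by
          gcongr
        _ = (q + 1) * (|r| ^ j * ‖besselIntegral q r‖) +
              (q + 2) * (|r| ^ j * ‖besselIntegral (q + 2) r‖) := by ring
        _ ≤ (q + 1) * C + (q + 2) * D := by gcongr

theorem besselIntegral_zero_zero : besselIntegral 0 0 = π := by
  simp [besselIntegral, cosPhaseIntegral]

theorem tendsto_besselIntegral_atTop (p : ℕ) : Tendsto (besselIntegral p) atTop (𝓝 0) :=
  tendsto_cosPhaseIntegral_atTop _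

end Bessel

section EulerOperator

variable {E : Type*} [NormedAddCommGroup E] [NormedSpace ℝ E] {v : ℝ → E} {m : ℕ}

/-- The Euler-type operator `c + r d/dr`, which arises by integrating `r^c v(r)` by parts. -/
noncomputable def eulerOp (c : ℝ) (v : ℝ → E) (r : ℝ) : E :=
  c • v r + r • deriv v r

theorem contDiff_eulerOp (c : ℝ) (hv : ContDiff ℝ (m + 1 : ℕ) v) : ContDiff ℝ m (eulerOp c v) :=
  ((hv.of_le (mod_cast m.le_succ)).const_smul c).add
    (contDiff_id.smul (ContDiff.deriv' (mod_cast hv)))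

theorem iteratedDeriv_eulerOp (c : ℝ) (hv : ContDiff ℝ (m + 1 : ℕ) v) {j : ℕ} (hj : j ≤ m) :
    iteratedDeriv j (eulerOp c v) =
      fun r => (c + j) • iteratedDeriv j v r + r • iteratedDeriv (j + 1) v r := by
  have hderiv : ∀ i ≤ m, ∀ r, HasDerivAt (iteratedDeriv i v) (iteratedDeriv (i + 1) v r) r := by
    intro i hi r
    rw [iteratedDeriv_succ]
    exact (hv.differentiable_iteratedDeriv i (mod_cast Nat.lt_succ_of_le hi) r).hasDerivAt
  induction j with
  | zero =>
    ext r
    simp [eulerOp, iteratedDeriv_one]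
  | succ j ih =>
    rw [iteratedDeriv_succ, ih (Nat.le_of_succ_le hj)]
    ext r
    have h := ((hderiv j (Nat.le_of_succ_le hj) r).const_smul (c + j)).add
      ((hasDerivAt_id r).smul (hderiv (j + 1) hj r))
    refine h.deriv.trans ?_
    simp only [id, one_smul]
    push_cast
    module

/-- The derivatives of `v` of order at most `m + 1` are dominated on `(0, ∞)`, with weight
`(1 + r)^m`, by the integrable function `G`. -/
structure IsJetDominated (m : ℕ) (v : ℝ → E) (G : ℝ → ℝ) : Prop where
  contDiff : ContDiff ℝ (m + 1 : ℕ) v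
  integrableOn : IntegrableOn G (Set.Ioi 0)
  le : ∀ j ≤ m + 1, ∀ r, 0 < r → (1 + r) ^ m * ‖iteratedDeriv j v r‖ ≤ G r

namespace IsJetDominated

variable {G : ℝ → ℝ}

protected theorem eulerOp {c : ℝ} (h : IsJetDominated (m + 1) v G) (hc : 0 ≤ c) :
    IsJetDominated m (eulerOp c v) fun r => (c + m + 2) * G r where
  contDiff := contDiff_eulerOp c h.contDiff
  integrableOn := h.integrableOn.const_mul _
  le j hj r hr := by
    have hmono : (1 + r) ^ m ≤ (1 + r) ^ (m + 1) := pow_le_pow_right₀ (by linarith) m.le_succ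
    have hmul : (1 + r) ^ m * r ≤ (1 + r) ^ (m + 1) := by
      rw [pow_succ]
      gcongr
      linarith
    have hj' : (j : ℝ) ≤ m + 1 := mod_cast hj
    rw [iteratedDeriv_eulerOp c h.contDiff hj]
    calc (1 + r) ^ m * ‖(c + j) • iteratedDeriv j v r + r • iteratedDeriv (j + 1) v r‖
        ≤ (1 + r) ^ m * ((c + j) * ‖iteratedDeriv j v r‖ + r * ‖iteratedDeriv (j + 1) v r‖) := by
          gcongr
          refine (norm_add_le _ _).trans_eq ?_
          rw [norm_smul, norm_smul, Real.norm_of_nonneg hr.le, Real.norm_of_nonneg (by positivity)]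
      _ = (c + j) * ((1 + r) ^ m * ‖iteratedDeriv j v r‖) +
            (1 + r) ^ m * r * ‖iteratedDeriv (j + 1) v r‖ := by ring
      _ ≤ (c + (m + 1)) * ((1 + r) ^ (m + 1) * ‖iteratedDeriv j v r‖) +
            (1 + r) ^ (m + 1) * ‖iteratedDeriv (j + 1) v r‖ := by gcongr
      _ ≤ (c + (m + 1)) * G r + G r := by
          gcongr
          · exact h.le j (by omega) r hr
          · exact h.le (j + 1) (by omega) r hr
      _ = (c + m + 2) * G r := by ring

theorem integrableOn_pow_smul_iteratedDeriv (h : IsJetDominated m v G) {a j : ℕ} (ha : a ≤ m)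
    (hj : j ≤ m + 1) : IntegrableOn (fun r => r ^ a • iteratedDeriv j v r) (Set.Ioi 0) := by
  have hcont := h.contDiff.continuous_iteratedDeriv j (mod_cast hj)
  refine h.integrableOn.mono' (Continuous.aestronglyMeasurable (by fun_prop)) ?_
  filter_upwards [ae_restrict_mem measurableSet_Ioi] with r (hr : 0 < r)
  rw [norm_smul, norm_pow, Real.norm_of_nonneg hr.le]
  refine le_trans ?_ (h.le j hj r hr)
  gcongr
  exact (pow_le_pow_left₀ hr.le (by linarith) a).trans (pow_le_pow_right₀ (by linarith) ha)

theorem integrableOn_pow_smul (h : IsJetDominated m v G) {a : ℕ} (ha : a ≤ m) :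
    IntegrableOn (fun r => r ^ a • v r) (Set.Ioi 0) := by
  simpa only [iteratedDeriv_zero] using h.integrableOn_pow_smul_iteratedDeriv ha (Nat.zero_le _)

end IsJetDominated

end EulerOperator

section RadialIntegral

variable {X : Type*} [NormedAddCommGroup X] [NormedSpace ℂ X] {R : ℝ} {v : ℝ → X}

theorem integrableOn_pow_mul_besselIntegral_smul {a j q : ℕ} (hjq : 2 * j ≤ q) (hR : 0 < R)
    (hv : IntegrableOn (fun r => r ^ a • v r) (Set.Ioi 0)) :
    IntegrableOn (fun r : ℝ => ((r ^ (a + j) : ℝ) * besselIntegral q (R * r) : ℂ) • v r)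
      (Set.Ioi 0) := by
  obtain ⟨C, hC⟩ := exists_pow_mul_norm_besselIntegral_le hjq
  have hcont := continuous_besselIntegral q
  have hbound : ∀ r : ℝ, ‖((r ^ j : ℝ) * besselIntegral q (R * r) : ℂ)‖ ≤ C / R ^ j := by
    intro r
    rw [le_div_iff₀ (by positivity), norm_mul, Complex.norm_real, norm_pow, Real.norm_eq_abs]
    refine le_of_eq_of_le ?_ (hC (R * r)).1
    rw [abs_mul, abs_of_pos hR]
    ring
  have h := hv.bdd_smul (C / R ^ j) (φ := fun r : ℝ => ((r ^ j : ℝ) * besselIntegral q (R * r) : ℂ))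
    (Continuous.aestronglyMeasurable (by fun_prop)) (Eventually.of_forall hbound)
  refine h.congr (Eventually.of_forall fun r => ?_)
  simp only [Pi.smul_apply', ← Complex.coe_smul, smul_smul]
  congr 1
  push_cast
  ring

theorem hasDerivAt_besselIntegral_mul (p : ℕ) (R r : ℝ) :
    HasDerivAt (fun r => besselIntegral p (R * r))
      (-((R ^ 2 * r / (p + 1) : ℝ) : ℂ) * besselIntegral (p + 2) (R * r)) r := by
  refine ((hasDerivAt_besselIntegral p (R * r)).scomp r
    ((hasDerivAt_id r).const_mul R)).congr_deriv ?_
  rw [Complex.real_smul]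
  push_cast
  ring

theorem integral_Ioi_deriv_eq_neg {E : Type*} [NormedAddCommGroup E] [NormedSpace ℝ E]
    [CompleteSpace E] {f f' : ℝ → E} {a : ℝ} (hf : ∀ x ∈ Set.Ici a, HasDerivAt f (f' x) x)
    (hfi : IntegrableOn f (Set.Ioi a)) (hfi' : IntegrableOn f' (Set.Ioi a)) :
    ∫ x in Set.Ioi a, f' x = -f a := by
  have hlim := tendsto_zero_of_hasDerivAt_of_integrableOn_Ioi
    (fun x hx => hf x (Set.Ioi_subset_Ici_self hx)) hfi' hfi
  rw [integral_Ioi_of_hasDerivAt_of_tendsto' hf hfi' hlim, zero_sub]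

/-- The action on `v` of the radial part of the spherical Dirichlet kernel in dimension `p + 1`. -/
noncomputable def besselRadialIntegral (p : ℕ) (R : ℝ) (v : ℝ → X) : X :=
  ∫ r in Set.Ioi (0 : ℝ), ((R ^ (p + 1) * r ^ p : ℝ) * besselIntegral (p + 1) (R * r) : ℂ) • v r

theorem integrableOn_besselRadialIntegrand {a j p : ℕ} (hp : p = a + j) (hj : 2 * j ≤ p + 1)
    (hR : 0 < R) (hv : IntegrableOn (fun r => r ^ a • v r) (Set.Ioi 0)) :
    IntegrableOn (fun r : ℝ =>
      ((R ^ (p + 1) * r ^ p : ℝ) * besselIntegral (p + 1) (R * r) : ℂ) • v r) (Set.Ioi 0) := by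
  subst hp
  refine ((integrableOn_pow_mul_besselIntegral_smul hj hR hv).smul
    ((R ^ (a + j + 1) : ℝ) : ℂ)).congr (Eventually.of_forall fun r => ?_)
  simp only [Pi.smul_apply, smul_smul]
  congr 1
  push_cast
  ring

theorem besselRadialIntegral_one [CompleteSpace X] (hR : 0 < R) (hv : ContDiff ℝ 1 v)
    (hvi : IntegrableOn v (Set.Ioi 0)) (hvi' : IntegrableOn (deriv v) (Set.Ioi 0)) :
    besselRadialIntegral 1 R v =
      (π : ℂ) • v 0 + ∫ r in Set.Ioi (0 : ℝ), besselIntegral 0 (R * r) • deriv v r := by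
  have hbounded : ∀ w : ℝ → X, IntegrableOn w (Set.Ioi 0) →
      IntegrableOn (fun r : ℝ => besselIntegral 0 (R * r) • w r) (Set.Ioi 0) := fun w hw => by
    simpa using integrableOn_pow_mul_besselIntegral_smul (a := 0) (j := 0) le_rfl hR (by simpa)
  have hJ := integrableOn_besselRadialIntegrand (a := 0) (j := 1) (p := 1) rfl le_rfl hR
    (by simpa using hvi)
  have hderiv : ∀ r ∈ Set.Ici (0 : ℝ), HasDerivAt (fun r : ℝ => besselIntegral 0 (R * r) • v r)
      (besselIntegral 0 (R * r) • deriv v r -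
        ((R ^ (1 + 1) * r ^ 1 : ℝ) * besselIntegral (1 + 1) (R * r) : ℂ) • v r) r := by
    intro r _
    refine ((hasDerivAt_besselIntegral_mul 0 R r).smul
      (hv.differentiable one_ne_zero r).hasDerivAt).congr_deriv ?_
    push_cast
    module
  have hFTC := integral_Ioi_deriv_eq_neg hderiv (hbounded v hvi) ((hbounded _ hvi').sub hJ)
  rw [integral_sub (hbounded _ hvi') hJ, mul_zero, besselIntegral_zero_zero] at hFTC
  rw [besselRadialIntegral, ← sub_eq_iff_eq_add', ← neg_eq_iff_eq_neg.2 hFTC]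
  abel

theorem besselRadialIntegral_add_two [CompleteSpace X] {a j p : ℕ} (hp : p = a + j)
    (hj : 2 * j ≤ p + 1) (hR : 0 < R) (hv : ContDiff ℝ 1 v)
    (hvi : IntegrableOn (fun r => r ^ (a + 1) • v r) (Set.Ioi 0))
    (hEvi : IntegrableOn (fun r => r ^ a • eulerOp (p + 1) v r) (Set.Ioi 0)) :
    besselRadialIntegral (p + 2) R v =
      (p + 2 : ℝ) • besselRadialIntegral p R (eulerOp (p + 1) v) := by
  have hJ₁ := integrableOn_besselRadialIntegrand hp hj hR hEvi
  have hJ₂ := (integrableOn_besselRadialIntegrand (p := p + 2) (j := j + 1) (by omega) (by omega)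
    hR hvi).smul (p + 2 : ℝ)⁻¹
  have hprimitive : IntegrableOn (fun r : ℝ =>
      ((R ^ (p + 1) * r ^ (p + 1) : ℝ) * besselIntegral (p + 1) (R * r) : ℂ) • v r)
      (Set.Ioi 0) := by
    refine ((integrableOn_pow_mul_besselIntegral_smul hj hR hvi).smul
      ((R ^ (p + 1) : ℝ) : ℂ)).congr (Eventually.of_forall fun r => ?_)
    simp only [Pi.smul_apply, smul_smul, hp]
    congr 1
    push_cast
    ring
  have hderiv : ∀ r ∈ Set.Ici (0 : ℝ), HasDerivAt (fun r : ℝ =>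
      ((R ^ (p + 1) * r ^ (p + 1) : ℝ) * besselIntegral (p + 1) (R * r) : ℂ) • v r)
      (((R ^ (p + 1) * r ^ p : ℝ) * besselIntegral (p + 1) (R * r) : ℂ) • eulerOp (p + 1) v r -
        (p + 2 : ℝ)⁻¹ • ((R ^ (p + 2 + 1) * r ^ (p + 2) : ℝ) *
          besselIntegral (p + 2 + 1) (R * r) : ℂ) • v r) r := by
    intro r _
    have hpow := ((hasDerivAt_pow (p + 1) r).const_mul (R ^ (p + 1))).ofReal_comp
    refine ((hpow.fun_mul (hasDerivAt_besselIntegral_mul (p + 1) R r)).smul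
      (hv.differentiable one_ne_zero r).hasDerivAt).congr_deriv ?_
    simp only [eulerOp, ← Complex.coe_smul]
    push_cast
    match_scalars
    · field_simp
      ring
    · ring
  have hFTC := integral_Ioi_deriv_eq_neg hderiv hprimitive (hJ₁.sub hJ₂)
  rw [integral_sub hJ₁ (by exact hJ₂), integral_smul, zero_pow p.succ_ne_zero, mul_zero,
    Complex.ofReal_zero, zero_mul, zero_smul, neg_zero, sub_eq_zero] at hFTC
  rw [besselRadialIntegral, besselRadialIntegral, hFTC, smul_inv_smul₀ (by positivity)]

/-- The constant of `norm_besselRadialIntegral_sub_le`, collected over the reductions from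
dimension `2m + 2` down to dimension `2`. -/
def radialErrorConst (m : ℕ) : ℝ :=
  ∏ i ∈ Finset.range m, ((2 * i + 3) * (3 * i + 4) : ℝ)

theorem radialErrorConst_succ (m : ℕ) :
    radialErrorConst (m + 1) = radialErrorConst m * ((2 * m + 3) * (3 * m + 4)) :=
  Finset.prod_range_succ _ _

theorem IsJetDominated.norm_besselRadialIntegral_one_sub_le [CompleteSpace X] {G : ℝ → ℝ}
    (hv : IsJetDominated 0 v G) (hR : 0 < R) :
    ‖besselRadialIntegral 1 R v - π • v 0‖ ≤
      ∫ r in Set.Ioi (0 : ℝ), ‖besselIntegral 0 (R * r)‖ * G r := by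
  have hvi : IntegrableOn v (Set.Ioi 0) := by simpa using hv.integrableOn_pow_smul le_rfl
  have hvi' : IntegrableOn (deriv v) (Set.Ioi 0) := by
    simpa [iteratedDeriv_one] using hv.integrableOn_pow_smul_iteratedDeriv (j := 1) le_rfl le_rfl
  rw [besselRadialIntegral_one hR (mod_cast hv.contDiff) hvi hvi', Complex.coe_smul,
    add_sub_cancel_left]
  have hcont := continuous_besselIntegral 0
  refine norm_integral_le_of_norm_le ?_ ?_
  · refine hv.integrableOn.bdd_mul (c := π) (Continuous.aestronglyMeasurable (by fun_prop))
      (Eventually.of_forall fun r => ?_)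
    rw [norm_norm]
    exact norm_besselIntegral_le _ _
  · filter_upwards [ae_restrict_mem measurableSet_Ioi] with r hr
    rw [norm_smul]
    gcongr
    simpa [iteratedDeriv_one] using hv.le 1 le_rfl r hr

theorem IsJetDominated.norm_besselRadialIntegral_sub_le [CompleteSpace X] {m : ℕ} {G : ℝ → ℝ}
    (hv : IsJetDominated m v G) (hR : 0 < R) :
    ‖besselRadialIntegral (2 * m + 1) R v - (π * (2 * m + 1).factorial) • v 0‖ ≤
      radialErrorConst m * ∫ r in Set.Ioi (0 : ℝ), ‖besselIntegral 0 (R * r)‖ * G r := by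
  induction m generalizing v G with
  | zero => simpa [radialErrorConst] using hv.norm_besselRadialIntegral_one_sub_le hR
  | succ m ih =>
    have hEv : IsJetDominated m (eulerOp ((2 * m + 1 : ℕ) + 1) v) fun r => (3 * m + 4) * G r := by
      convert hv.eulerOp (c := (2 * m + 1 : ℕ) + 1) (by positivity) using 3
      push_cast
      ring
    have hreduce : besselRadialIntegral (2 * (m + 1) + 1) R v =
        ((2 * m + 1 : ℕ) + 2 : ℝ) •
          besselRadialIntegral (2 * m + 1) R (eulerOp ((2 * m + 1 : ℕ) + 1) v) :=
      besselRadialIntegral_add_two (a := m) (j := m + 1) (p := 2 * m + 1) (by ring) (by omega)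
        hR (hv.contDiff.of_le (mod_cast Nat.le_add_left 1 _)) (hv.integrableOn_pow_smul le_rfl)
        (hEv.integrableOn_pow_smul le_rfl)
    have hcast : ((2 * m + 1 : ℕ) + 2 : ℝ) = 2 * m + 3 := by
      push_cast
      ring
    have hvalue : (π * (2 * (m + 1) + 1).factorial) • v 0 = (2 * m + 3 : ℝ) •
        (π * (2 * m + 1).factorial) • eulerOp ((2 * m + 1 : ℕ) + 1) v 0 := by
      rw [eulerOp, zero_smul, add_zero, smul_smul, smul_smul,
        show 2 * (m + 1) + 1 = (2 * m + 1) + 1 + 1 by ring, Nat.factorial_succ, Nat.factorial_succ]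
      push_cast
      congr 1
      ring
    rw [hreduce, hcast, hvalue, ← smul_sub, norm_smul, Real.norm_of_nonneg (by positivity)]
    calc (2 * m + 3 : ℝ) * _
        ≤ (2 * m + 3) * (radialErrorConst m *
            ∫ r in Set.Ioi (0 : ℝ), ‖besselIntegral 0 (R * r)‖ * ((3 * m + 4) * G r)) := by
          gcongr
          exact ih hEv
      _ = radialErrorConst (m + 1) * ∫ r in Set.Ioi (0 : ℝ), ‖besselIntegral 0 (R * r)‖ * G r := by
          simp_rw [mul_left_comm _ (3 * (m : ℝ) + 4)]
          rw [integral_const_mul, radialErrorConst_succ]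
          ring

end RadialIntegral

section Derivatives

variable {E X : Type*} [NormedAddCommGroup E] [NormedSpace ℝ E] [NormedAddCommGroup X]
  [NormedSpace ℝ X] {F : E → X}

/-- The iterated directional derivative along the directions of a list, the last one first. -/
noncomputable def listDeriv (F : E → X) : List E → E → X
  | [] => F
  | a :: l => fun x => fderiv ℝ (listDeriv F l) x a

theorem contDiff_listDeriv (l : List E) {m : ℕ} (hF : ContDiff ℝ (m + l.length : ℕ) F) :
    ContDiff ℝ m (listDeriv F l) := by
  induction l generalizing m with
  | nil => simpa [listDeriv] using hF
  | cons a l ih =>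
    have h : ContDiff ℝ (m + 1 : ℕ) (listDeriv F l) := ih (by
      rwa [List.length_cons, add_comm l.length, ← add_assoc] at hF)
    exact (h.fderiv_right (m := m) (by norm_cast)).clm_apply contDiff_const

theorem listDeriv_swap {l : List E} (hF : ContDiff ℝ (2 + l.length : ℕ) F) (a b : E) :
    listDeriv F (b :: a :: l) = listDeriv F (a :: b :: l) := by
  have h2 : ContDiff ℝ 2 (listDeriv F l) := contDiff_listDeriv (m := 2) l hF
  ext x
  have hdiff : DifferentiableAt ℝ (fderiv ℝ (listDeriv F l)) x :=
    (h2.fderiv_right (m := 1) (by norm_num)).differentiable one_ne_zero x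
  have hsnd : ∀ c d : E, fderiv ℝ (fun y => fderiv ℝ (listDeriv F l) y c) x d =
      fderiv ℝ (fderiv ℝ (listDeriv F l)) x d c := by
    intro c d
    rw [fderiv_clm_apply hdiff (differentiableAt_const c)]
    simp
  simp only [listDeriv, hsnd]
  exact h2.contDiffAt.isSymmSndFDerivAt (by simp) _ _

theorem listDeriv_perm {l l' : List E} (h : l.Perm l') (hF : ContDiff ℝ (l.length : ℕ) F) :
    listDeriv F l = listDeriv F l' := by
  induction h with
  | nil => rfl
  | cons a _ ih => rw [listDeriv, listDeriv, ih (hF.of_le (mod_cast Nat.le_succ _))]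
  | swap a b l => exact listDeriv_swap (by rwa [add_comm]) a b
  | trans h₁ _ ih₁ ih₂ => rw [ih₁ hF, ih₂ (by rwa [← h₁.length_eq])]

theorem iteratedFDeriv_apply_eq_listDeriv {j : ℕ} (hF : ContDiff ℝ j F) (v : Fin j → E) (x : E) :
    iteratedFDeriv ℝ j F x v = listDeriv F (List.ofFn v) x := by
  induction j generalizing x with
  | zero => simp [listDeriv]
  | succ j ih =>
    have hdiff : DifferentiableAt ℝ (iteratedFDeriv ℝ j F) x :=
      hF.differentiable_iteratedFDeriv (mod_cast j.lt_succ_self) x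
    have hfderiv := (hdiff.hasFDerivAt.continuousMultilinear_apply_const
      (fun i : Fin j => v i.succ)).fderiv
    have hlist : listDeriv F (List.ofFn fun i => v i.succ) =
        fun y => iteratedFDeriv ℝ j F y fun i => v i.succ :=
      funext fun y => (ih (hF.of_le (mod_cast j.le_succ)) _ y).symm
    simp only [List.ofFn_succ, listDeriv, hlist, hfderiv, iteratedFDeriv_succ_apply_left]
    rfl

-- Mathlib's `ContDiffAt.iteratedFDeriv_comp_perm` assumes analyticity.
theorem iteratedFDeriv_comp_equiv {i j : ℕ} (hF : ContDiff ℝ j F) (e : Fin i ≃ Fin j)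
    (v : Fin j → E) (x : E) : iteratedFDeriv ℝ i F x (v ∘ e) = iteratedFDeriv ℝ j F x v := by
  obtain rfl : i = j := by simpa using Fintype.card_congr e
  rw [iteratedFDeriv_apply_eq_listDeriv hF, iteratedFDeriv_apply_eq_listDeriv hF,
    listDeriv_perm (Equiv.Perm.ofFn_comp_perm e v) (by simpa using hF)]

theorem iteratedDeriv_comp_add_smul {k j : ℕ} (hF : ContDiff ℝ k F) (hj : j ≤ k) (x w : E)
    (r : ℝ) : iteratedDeriv j (fun r : ℝ => F (x + r • w)) r =
      iteratedFDeriv ℝ j F (x + r • w) fun _ => w := by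
  have hcomp := (ContinuousLinearMap.toSpanSingleton ℝ w).iteratedFDeriv_comp_right
    (hF.comp (contDiff_const.add contDiff_id) : ContDiff ℝ k fun y => F (x + y)) r (mod_cast hj)
  rw [iteratedDeriv_eq_iteratedFDeriv]
  simpa [Function.comp_def, iteratedFDeriv_comp_add_left] using
    congrArg (fun f : ContinuousMultilinearMap ℝ (fun _ : Fin j => ℝ) X => f fun _ => 1) hcomp

theorem norm_iteratedDeriv_comp_add_smul_le {k j : ℕ} (hF : ContDiff ℝ k F) (hj : j ≤ k)
    (x w : E) (r : ℝ) : ‖iteratedDeriv j (fun r : ℝ => F (x + r • w)) r‖ ≤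
      ‖iteratedFDeriv ℝ j F (x + r • w)‖ * ‖w‖ ^ j := by
  rw [iteratedDeriv_comp_add_smul hF hj]
  simpa using (iteratedFDeriv ℝ j F (x + r • w)).le_opNorm fun _ => w

theorem norm_continuousMultilinearMap_le_of_orthonormalBasis {V ι κ : Type*}
    [NormedAddCommGroup V] [InnerProductSpace ℝ V] [Fintype ι] [Fintype κ]
    (b : OrthonormalBasis κ ℝ V) (f : ContinuousMultilinearMap ℝ (fun _ : ι => V) X) {B : ℝ}
    (hB : ∀ s : ι → κ, ‖f fun i => b (s i)‖ ≤ B) :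
    ‖f‖ ≤ (Fintype.card κ : ℝ) ^ Fintype.card ι * B := by
  classical
  have hcount : ∑ _s : ι → κ, B = (Fintype.card κ : ℝ) ^ Fintype.card ι * B := by simp
  have hnonneg : 0 ≤ ∑ _s : ι → κ, B :=
    Finset.sum_nonneg fun s _ => (norm_nonneg _).trans (hB s)
  rw [← hcount]
  refine f.opNorm_le_bound hnonneg fun v => ?_
  have hexpand : v = fun i => ∑ c, b.repr (v i) c • b c := funext fun i => (b.sum_repr (v i)).symm
  have hcoord : ∀ i c, ‖b.repr (v i) c‖ ≤ ‖v i‖ := fun i c =>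
    (PiLp.norm_apply_le _ c).trans_eq (b.repr.norm_map _)
  calc ‖f v‖ = ‖∑ s : ι → κ, (∏ i, b.repr (v i) (s i)) • f fun i => b (s i)‖ := by
        conv_lhs => rw [hexpand, ContinuousMultilinearMap.map_sum]
        simp_rw [ContinuousMultilinearMap.map_smul_univ]
    _ ≤ ∑ _s : ι → κ, (∏ i, ‖v i‖) * B := by
        refine norm_sum_le_of_le _ fun s _ => ?_
        rw [norm_smul, norm_prod]
        gcongr with i
        · exact hcoord i (s i)
        · exact hB s
    _ = (∑ _s : ι → κ, B) * ∏ i, ‖v i‖ := by rw [← Finset.mul_sum, mul_comm]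

end Derivatives

section MultiIndex

variable {n j : ℕ} {X : Type*} [NormedAddCommGroup X] [NormedSpace ℂ X]
  {F : EuclideanSpace ℝ (Fin n) → X}

theorem exists_multiPartialDeriv_eq (hF : ContDiff ℝ j F) (s : Fin j → Fin n) :
    ∃ α : Fin n → ℕ, ∑ i, α i = j ∧ ∀ x, iteratedFDeriv ℝ j F x
      (fun a => EuclideanSpace.single (s a) (1 : ℝ)) = multiPartialDeriv α F x := by
  obtain ⟨α, e, he⟩ : ∃ (α : Fin n → ℕ) (e : Fin j ≃ Fin (∑ i, α i)),
      ∀ a, (finSigmaFinEquiv.symm (e a)).1 = s a := by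
    refine ⟨fun i => Fintype.card {a // s a = i}, ((Equiv.sigmaFiberEquiv s).symm.trans
      (Equiv.sigmaCongrRight fun i => Fintype.equivFin {a // s a = i})).trans finSigmaFinEquiv,
      fun a => ?_⟩
    simp [Equiv.sigmaFiberEquiv, Equiv.sigmaCongrRight]
  have hj : ∑ i, α i = j := by simpa using (Fintype.card_congr e).symm
  refine ⟨α, hj, fun x => ?_⟩
  rw [multiPartialDeriv, ← iteratedFDeriv_comp_equiv (hj ▸ hF) e]
  simp only [Function.comp_def, he]

theorem norm_iteratedFDeriv_le_of_multiPartialDeriv (hF : ContDiff ℝ j F) {B : ℝ}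
    {x : EuclideanSpace ℝ (Fin n)}
    (hB : ∀ α : Fin n → ℕ, ∑ i, α i = j → ‖multiPartialDeriv α F x‖ ≤ B) :
    ‖iteratedFDeriv ℝ j F x‖ ≤ n ^ j * B := by
  simpa using norm_continuousMultilinearMap_le_of_orthonormalBasis
    (EuclideanSpace.basisFun (Fin n) ℝ) (iteratedFDeriv ℝ j F x) (B := B) fun s => by
      obtain ⟨α, hα, heq⟩ := exists_multiPartialDeriv_eq hF s
      simpa only [EuclideanSpace.basisFun_apply, heq] using hB α hα

theorem norm_iteratedFDeriv_le_of_multiPartialDeriv_le [NeZero n] {k : ℕ} (hF : ContDiff ℝ k F)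
    (hj : j ≤ k) {B : ℝ} {x : EuclideanSpace ℝ (Fin n)}
    (hB : ∀ α : Fin n → ℕ, ∑ i, α i ≤ k → ‖multiPartialDeriv α F x‖ ≤ B) :
    ‖iteratedFDeriv ℝ j F x‖ ≤ n ^ k * B := by
  have hB0 : 0 ≤ B := (norm_nonneg _).trans (hB 0 (by simp))
  have hn : (1 : ℝ) ≤ n := mod_cast NeZero.one_le
  calc ‖iteratedFDeriv ℝ j F x‖ ≤ n ^ j * B :=
        norm_iteratedFDeriv_le_of_multiPartialDeriv (hF.of_le (mod_cast hj)) fun α hα =>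
          hB α (hα.trans_le hj)
    _ ≤ n ^ k * B := by gcongr

end MultiIndex

section BallFourier

open Metric

variable {E : Type*} [NormedAddCommGroup E] [NormedSpace ℝ E]

theorem integral_sqrt_one_sub_sq_pow_smul (m : ℕ) {f : ℝ → E} (hf : Continuous f) :
    ∫ t in (-1 : ℝ)..1, √(1 - t ^ 2) ^ m • f t =
      ∫ θ in (0 : ℝ)..π, Real.sin θ ^ (m + 1) • f (Real.cos θ) := by
  have hsubst := intervalIntegral.integral_deriv_smul_comp (a := 0) (b := π) (f := Real.cos)
    (f' := fun θ => -Real.sin θ) (g := fun t => √(1 - t ^ 2) ^ m • f t)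
    (fun θ _ => Real.hasDerivAt_cos θ) (by fun_prop) (by fun_prop)
  rw [Real.cos_zero, Real.cos_pi, intervalIntegral.integral_symm (-1) 1] at hsubst
  rw [← neg_inj, ← hsubst, ← intervalIntegral.integral_neg]
  refine intervalIntegral.integral_congr fun θ hθ => ?_
  rw [Set.uIcc_of_le Real.pi_pos.le] at hθ
  have hsin : √(1 - Real.cos θ ^ 2) = Real.sin θ := by
    rw [← Real.sin_sq, Real.sqrt_sq (Real.sin_nonneg_of_mem_Icc hθ)]
  simp only [Function.comp_apply, hsin]
  rw [neg_smul, smul_smul, ← pow_succ']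

variable [CompleteSpace E]

theorem setIntegral_comp_fst {α β : Type*} [MeasurableSpace α] [MeasurableSpace β]
    {μ : Measure α} {ν : Measure β} [SFinite μ] [SFinite ν] {A : Set (α × β)}
    (hA : MeasurableSet A) {f : α → E} (hf : IntegrableOn (fun p => f p.1) A (μ.prod ν)) :
    ∫ p in A, f p.1 ∂μ.prod ν = ∫ a, ν.real (Prod.mk a ⁻¹' A) • f a ∂μ := by
  rw [← integral_indicator hA, integral_prod _ ((integrable_indicator_iff hA).2 hf)]
  congr 1 with a
  rw [← setIntegral_const, ← integral_indicator (measurable_prodMk_left hA)]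
  rfl

theorem volume_real_sum_sq_le (m : ℕ) {s : ℝ} (hs : 0 ≤ s) :
    volume.real {z : Fin m → ℝ | ∑ i, z i ^ 2 ≤ s} =
      √s ^ m * volume.real (ball (0 : EuclideanSpace ℝ (Fin m)) 1) := by
  have hball := Measure.addHaar_real_closedBall (volume : Measure (EuclideanSpace ℝ (Fin m))) 0
    (Real.sqrt_nonneg s)
  rw [finrank_euclideanSpace_fin] at hball
  rw [← hball, Measure.real, Measure.real,
    ← (EuclideanSpace.volume_preserving_symm_measurableEquiv_toLp
      (Fin m)).measure_preimage_equiv {z : Fin m → ℝ | ∑ i, z i ^ 2 ≤ s}]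
  congr 2
  ext z
  rw [Set.mem_preimage, mem_closedBall_zero_iff, EuclideanSpace.norm_eq, Real.sqrt_le_sqrt_iff hs]
  simp

theorem volume_real_slice_sum_sq_le_one (m : ℕ) (t : ℝ) :
    volume.real {z : Fin m → ℝ | t ^ 2 + ∑ i, z i ^ 2 ≤ 1} = (Set.Icc (-1) 1).indicator
      (fun t => √(1 - t ^ 2) ^ m * volume.real (ball (0 : EuclideanSpace ℝ (Fin m)) 1)) t := by
  by_cases ht : t ∈ Set.Icc (-1 : ℝ) 1
  · have hnonneg : 0 ≤ 1 - t ^ 2 := by nlinarith [ht.1, ht.2]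
    rw [Set.indicator_of_mem ht, ← volume_real_sum_sq_le m hnonneg]
    simp only [le_sub_iff_add_le']
  · have hempty : {z : Fin m → ℝ | t ^ 2 + ∑ i, z i ^ 2 ≤ 1} = ∅ := by
      refine Set.eq_empty_of_forall_notMem fun z hz => ht ?_
      have hz : t ^ 2 + ∑ i, z i ^ 2 ≤ 1 := hz
      have hsum : 0 ≤ ∑ i, z i ^ 2 := Finset.sum_nonneg fun i _ => sq_nonneg _
      exact abs_le.1 ((sq_le_one_iff_abs_le_one t).1 (by linarith))
    rw [Set.indicator_of_notMem ht, hempty, measureReal_empty]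

theorem setIntegral_closedBall_apply_zero_eq_integral_slice (m : ℕ) {f : ℝ → E}
    (hf : Continuous f) :
    ∫ ξ in closedBall (0 : EuclideanSpace ℝ (Fin (m + 1))) 1, f (ξ 0) =
      ∫ t, volume.real {z : Fin m → ℝ | t ^ 2 + ∑ i, z i ^ 2 ≤ 1} • f t := by
  let e : EuclideanSpace ℝ (Fin (m + 1)) ≃ᵐ ℝ × (Fin m → ℝ) :=
    (MeasurableEquiv.toLp 2 (Fin (m + 1) → ℝ)).symm.trans
      (MeasurableEquiv.piFinSuccAbove (fun _ => ℝ) 0)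
  have he : MeasurePreserving e volume volume :=
    (EuclideanSpace.volume_preserving_symm_measurableEquiv_toLp (Fin (m + 1))).trans
      (volume_preserving_piFinSuccAbove (fun _ : Fin (m + 1) => ℝ) 0)
  let A : Set (ℝ × (Fin m → ℝ)) := {p | p.1 ^ 2 + ∑ i, p.2 i ^ 2 ≤ 1}
  have hA : e ⁻¹' A = closedBall 0 1 := by
    ext ξ
    rw [mem_closedBall_zero_iff, EuclideanSpace.norm_eq, Real.sqrt_le_one, Fin.sum_univ_succ]
    simp [A, e, MeasurableEquiv.piFinSuccAbove, Fin.tail]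
  have hint : IntegrableOn (fun p => f p.1) A (volume.prod volume) := by
    rw [← Measure.volume_eq_prod, ← he.integrableOn_comp_preimage e.measurableEmbedding, hA]
    exact (by fun_prop : Continuous fun ξ : EuclideanSpace ℝ (Fin (m + 1)) => f (ξ 0)).continuousOn
      |>.integrableOn_compact (isCompact_closedBall _ _)
  calc ∫ ξ in closedBall (0 : EuclideanSpace ℝ (Fin (m + 1))) 1, f (ξ 0)
      = ∫ p in A, f p.1 := by
        rw [← he.setIntegral_preimage_emb e.measurableEmbedding (fun p => f p.1) A, hA]
        rfl
    _ = ∫ t, volume.real (Prod.mk t ⁻¹' A) • f t := by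
        rw [Measure.volume_eq_prod,
          setIntegral_comp_fst (measurableSet_le (by fun_prop) (by fun_prop)) hint]

theorem setIntegral_closedBall_apply_zero (m : ℕ) {f : ℝ → E} (hf : Continuous f) :
    ∫ ξ in closedBall (0 : EuclideanSpace ℝ (Fin (m + 1))) 1, f (ξ 0) =
      volume.real (ball (0 : EuclideanSpace ℝ (Fin m)) 1) •
        ∫ t in (-1 : ℝ)..1, √(1 - t ^ 2) ^ m • f t := by
  have hslice : ∀ t : ℝ, volume.real {z : Fin m → ℝ | t ^ 2 + ∑ i, z i ^ 2 ≤ 1} • f t =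
      (Set.Icc (-1) 1).indicator (fun t =>
        volume.real (ball (0 : EuclideanSpace ℝ (Fin m)) 1) • √(1 - t ^ 2) ^ m • f t) t := by
    intro t
    rw [volume_real_slice_sum_sq_le_one]
    by_cases ht : t ∈ Set.Icc (-1 : ℝ) 1
    · rw [Set.indicator_of_mem ht, Set.indicator_of_mem ht, smul_smul, mul_comm]
    · rw [Set.indicator_of_notMem ht, Set.indicator_of_notMem ht, zero_smul]
  rw [setIntegral_closedBall_apply_zero_eq_integral_slice m hf]
  simp_rw [hslice]
  rw [integral_indicator measurableSet_Icc, integral_smul, integral_Icc_eq_integral_Ioc,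
    ← intervalIntegral.integral_of_le (by norm_num)]

theorem exists_linearIsometryEquiv_inner_eq_norm_mul {m : ℕ} (y : EuclideanSpace ℝ (Fin (m + 1))) :
    ∃ U : EuclideanSpace ℝ (Fin (m + 1)) ≃ₗᵢ[ℝ] EuclideanSpace ℝ (Fin (m + 1)),
      ∀ ξ, inner ℝ y ξ = ‖y‖ * U ξ 0 := by
  let v : EuclideanSpace ℝ (Fin (m + 1)) := EuclideanSpace.single 0 ‖y‖
  have hv : ‖y‖ = ‖v‖ := by simp [v]
  refine ⟨(Submodule.span ℝ {y - v})ᗮ.reflection, fun ξ => ?_⟩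
  rw [← LinearIsometryEquiv.inner_map_map (Submodule.span ℝ {y - v})ᗮ.reflection y ξ,
    Submodule.reflection_sub hv]
  simp [v, EuclideanSpace.inner_single_left]

theorem setIntegral_closedBall_one_cexp_inner {m : ℕ} (y : EuclideanSpace ℝ (Fin (m + 1))) :
    ∫ ξ in closedBall (0 : EuclideanSpace ℝ (Fin (m + 1))) 1,
        Complex.exp (Complex.I * (inner ℝ y ξ : ℝ)) =
      volume.real (ball (0 : EuclideanSpace ℝ (Fin m)) 1) * besselIntegral (m + 1) ‖y‖ := by
  obtain ⟨U, hU⟩ := exists_linearIsometryEquiv_inner_eq_norm_mul y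
  have hrotate := U.measurePreserving.setIntegral_preimage_emb
    U.toMeasurableEquiv.measurableEmbedding
    (fun ξ => Complex.exp (Complex.I * (‖y‖ * ξ 0 : ℝ))) (closedBall 0 1)
  rw [LinearIsometryEquiv.preimage_closedBall, map_zero] at hrotate
  have hcont : Continuous fun t : ℝ => Complex.exp (Complex.I * (‖y‖ * t : ℝ)) := by fun_prop
  simp_rw [hU]
  rw [hrotate, setIntegral_closedBall_apply_zero m hcont,
    integral_sqrt_one_sub_sq_pow_smul m hcont, Complex.real_smul, besselIntegral, cosPhaseIntegral]
  simp only [Complex.real_smul, mul_comm (Complex.exp _)]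

theorem setIntegral_closedBall_cexp_inner {m : ℕ} {R : ℝ} (hR : 0 < R)
    (y : EuclideanSpace ℝ (Fin (m + 1))) :
    ∫ ξ in closedBall (0 : EuclideanSpace ℝ (Fin (m + 1))) R,
        Complex.exp (Complex.I * (inner ℝ y ξ : ℝ)) =
      volume.real (ball (0 : EuclideanSpace ℝ (Fin m)) 1) *
        (R ^ (m + 1) * besselIntegral (m + 1) (R * ‖y‖)) := by
  have hscale := Measure.setIntegral_comp_smul (volume : Measure (EuclideanSpace ℝ (Fin (m + 1))))
    (fun ξ => Complex.exp (Complex.I * (inner ℝ y ξ : ℝ))) (closedBall 0 1) hR.ne'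
  rw [_root_.smul_closedBall _ _ zero_le_one, smul_zero, mul_one, Real.norm_of_nonneg hR.le,
    finrank_euclideanSpace_fin, abs_of_pos (by positivity), eq_inv_smul_iff₀ (by positivity)]
    at hscale
  simp_rw [inner_smul_right, ← real_inner_smul_left] at hscale
  rw [← hscale, setIntegral_closedBall_one_cexp_inner, norm_smul, Real.norm_of_nonneg hR.le,
    Complex.real_smul]
  push_cast
  ring

end BallFourier

section Polar

open Metric

variable {E : Type*} [NormedAddCommGroup E] [NormedSpace ℝ E]

theorem integrable_volumeIoiPow_iff (p : ℕ) (h : ℝ → E) :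
    Integrable (fun r : Set.Ioi (0 : ℝ) => h r) (Measure.volumeIoiPow p) ↔
      IntegrableOn (fun r : ℝ => r ^ p • h r) (Set.Ioi 0) := by
  rw [integrableOn_iff_comap_subtypeVal measurableSet_Ioi, Measure.volumeIoiPow,
    integrable_withDensity_iff_integrable_smul' (by fun_prop) (by simp)]
  refine integrable_congr (Eventually.of_forall fun r => ?_)
  simp [ENNReal.toReal_ofReal (pow_nonneg r.2.out.le p)]

theorem integral_volumeIoiPow (p : ℕ) (h : ℝ → E) :
    ∫ r : Set.Ioi (0 : ℝ), h r ∂Measure.volumeIoiPow p = ∫ r in Set.Ioi (0 : ℝ), r ^ p • h r := by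
  rw [← integral_subtype_comap measurableSet_Ioi (fun r : ℝ => r ^ p • h r), Measure.volumeIoiPow,
    integral_withDensity_eq_integral_toReal_smul (by fun_prop) (by simp)]
  refine integral_congr_ae (Eventually.of_forall fun r => ?_)
  simp [ENNReal.toReal_ofReal (pow_nonneg r.2.out.le p)]

variable {V : Type*} [NormedAddCommGroup V] [NormedSpace ℝ V] [MeasurableSpace V] [BorelSpace V]
  [FiniteDimensional ℝ V] [Nontrivial V] (μ : Measure V) [μ.IsAddHaarMeasure] {f : V → E}

theorem measurePreserving_polar :
    MeasurePreserving (fun p : sphere (0 : V) 1 × Set.Ioi (0 : ℝ) => (p.2 : ℝ) • (p.1 : V))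
      (μ.toSphere.prod (Measure.volumeIoiPow (Module.finrank ℝ V - 1))) μ := by
  have hval := measurePreserving_subtype_coe (μa := μ) (measurableSet_singleton (0 : V)).compl
  rw [restrict_compl_singleton] at hval
  exact hval.comp (μ.measurePreserving_homeomorphUnitSphereProd.symm
    (homeomorphUnitSphereProd V).toMeasurableEquiv)

theorem ae_integrableOn_polar (hf : Integrable f μ) :
    ∀ᵐ ω : sphere (0 : V) 1 ∂μ.toSphere,
      IntegrableOn (fun r : ℝ => r ^ (Module.finrank ℝ V - 1) • f (r • (ω : V))) (Set.Ioi 0) := by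
  have hpolar := (measurePreserving_polar μ).integrable_comp_of_integrable hf
  filter_upwards [hpolar.prod_right_ae] with ω hω
  exact (integrable_volumeIoiPow_iff _ fun r => f (r • (ω : V))).1 hω

theorem integrable_integral_polar (hf : Integrable f μ) :
    Integrable (fun ω : sphere (0 : V) 1 =>
      ∫ r in Set.Ioi (0 : ℝ), r ^ (Module.finrank ℝ V - 1) • f (r • (ω : V))) μ.toSphere := by
  have hpolar := (measurePreserving_polar μ).integrable_comp_of_integrable hf
  simpa only [Function.comp_apply, ← integral_volumeIoiPow] using hpolar.integral_prod_left

theorem integral_eq_integral_polar (hf : Integrable f μ) :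
    ∫ x, f x ∂μ = ∫ ω : sphere (0 : V) 1,
      (∫ r in Set.Ioi (0 : ℝ), r ^ (Module.finrank ℝ V - 1) • f (r • (ω : V))) ∂μ.toSphere := by
  have hpolar := measurePreserving_polar μ
  rw [← hpolar.map_eq] at hf
  nth_rw 1 [← hpolar.map_eq]
  rw [integral_map hpolar.aemeasurable hf.1]
  simp only [← integral_volumeIoiPow]
  exact integral_prod _ (hf.comp_measurable hpolar.measurable)

end Polar

section DirichletKernel

open Metric

variable {n p : ℕ} {X : Type*} [NormedAddCommGroup X] [NormedSpace ℂ X]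
  {F : EuclideanSpace ℝ (Fin n) → X} {R : ℝ}

/-- The spherical Dirichlet kernel, by convolution with which the partial inversion `S_R` acts. -/
noncomputable def sphericalDirichletKernel (R : ℝ) (y : EuclideanSpace ℝ (Fin n)) : ℂ :=
  (1 : ℂ) / (2 * (π : ℂ)) ^ n *
    ∫ ξ in closedBall (0 : EuclideanSpace ℝ (Fin n)) R, Complex.exp (Complex.I * (inner ℝ y ξ : ℝ))

theorem sphericalDirichletKernel_neg (R : ℝ) (y : EuclideanSpace ℝ (Fin n)) :
    sphericalDirichletKernel R (-y) = sphericalDirichletKernel R y := by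
  let U := LinearIsometryEquiv.neg ℝ (E := EuclideanSpace ℝ (Fin n))
  have hreflect := U.measurePreserving.setIntegral_preimage_emb
    U.toMeasurableEquiv.measurableEmbedding
    (fun ξ => Complex.exp (Complex.I * (inner ℝ y ξ : ℝ))) (closedBall 0 R)
  rw [LinearIsometryEquiv.preimage_closedBall, map_zero] at hreflect
  rw [sphericalDirichletKernel, sphericalDirichletKernel, ← hreflect]
  simp [U]

theorem integrable_prod_cexp_inner_smul (hF : Integrable F) (R : ℝ)
    (x : EuclideanSpace ℝ (Fin n)) :
    Integrable (fun p : EuclideanSpace ℝ (Fin n) × EuclideanSpace ℝ (Fin n) =>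
      Complex.exp (Complex.I * (inner ℝ (x - p.2) p.1 : ℝ)) • F p.2)
      ((volume.restrict (closedBall 0 R)).prod volume) := by
  have : IsFiniteMeasure (volume.restrict (closedBall (0 : EuclideanSpace ℝ (Fin n)) R)) :=
    isFiniteMeasure_restrict.2 measure_closedBall_lt_top.ne
  exact (hF.comp_snd _).bdd_smul 1 (Continuous.aestronglyMeasurable (by fun_prop))
    (Eventually.of_forall fun _ => (Complex.norm_exp_I_mul_ofReal _).le)

theorem cexp_inner_smul_angularFourier (F : EuclideanSpace ℝ (Fin n) → X)
    (x ξ : EuclideanSpace ℝ (Fin n)) :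
    Complex.exp (Complex.I * (inner ℝ x ξ : ℝ)) • angularFourier F ξ =
      ∫ s, Complex.exp (Complex.I * (inner ℝ (x - s) ξ : ℝ)) • F s := by
  rw [angularFourier, ← integral_smul]
  congr 1 with s
  rw [smul_smul, ← Complex.exp_add, inner_sub_left, real_inner_comm ξ s]
  push_cast
  ring_nf

theorem fourierPartialInversion_eq_integral_kernel [CompleteSpace X] (hF : Integrable F) (R : ℝ)
    (x : EuclideanSpace ℝ (Fin n)) :
    fourierPartialInversion R F x = ∫ y, sphericalDirichletKernel R y • F (x + y) := by
  simp_rw [fourierPartialInversion, cexp_inner_smul_angularFourier]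
  rw [integral_integral_swap (integrable_prod_cexp_inner_smul hF R x), ← integral_smul,
    ← integral_add_left_eq_self _ x]
  congr 1 with y
  rw [← sphericalDirichletKernel_neg, sphericalDirichletKernel, mul_smul, integral_smul_const]
  simp only [sub_add_cancel_left]

/-- The factor `|B^p| / (2π)^{p+1}` that turns a Bessel integral into the spherical Dirichlet kernel
of `ℝ^{p+1}`. -/
noncomputable def dirichletConst (p : ℕ) : ℝ :=
  volume.real (ball (0 : EuclideanSpace ℝ (Fin p)) 1) / (2 * π) ^ (p + 1)

theorem sphericalDirichletKernel_eq (hR : 0 < R) (y : EuclideanSpace ℝ (Fin (p + 1))) :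
    sphericalDirichletKernel R y =
      dirichletConst p * (R ^ (p + 1) * besselIntegral (p + 1) (R * ‖y‖)) := by
  rw [sphericalDirichletKernel, setIntegral_closedBall_cexp_inner hR, dirichletConst]
  push_cast
  ring

theorem dirichletConst_mul_toSphere_univ (l : ℕ) :
    dirichletConst (2 * l + 1) * (π * (2 * l + 1).factorial) *
      (volume : Measure (EuclideanSpace ℝ (Fin (2 * l + 1 + 1)))).toSphere.real Set.univ = 1 := by
  have hodd := InnerProductSpace.volume_ball_of_dim_odd (k := l)
    (finrank_euclideanSpace_fin (𝕜 := ℝ) (n := 2 * l + 1)) 0 1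
  have heven := InnerProductSpace.volume_ball_of_dim_even (k := l + 1)
    (finrank_euclideanSpace_fin (𝕜 := ℝ) (n := 2 * l + 1 + 1)) 0 1
  have hfactorial : ((2 * l + 2 : ℝ) * (2 * l + 1).factorial) =
      2 ^ (l + 1) * (l + 1).factorial * (2 * l + 1).doubleFactorial := by
    have h := Nat.factorial_eq_mul_doubleFactorial (2 * l + 1)
    rw [show 2 * l + 1 + 1 = 2 * (l + 1) by ring, Nat.doubleFactorial_two_mul,
      show 2 * (l + 1) = 2 * l + 1 + 1 by ring, Nat.factorial_succ] at h
    exact_mod_cast h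
  have hdf := (Nat.doubleFactorial_pos (2 * l + 1)).ne'
  rw [finrank_euclideanSpace_fin, ENNReal.ofReal_one, one_pow, one_mul] at hodd heven
  rw [dirichletConst, Measure.toSphere_real_apply_univ, Measure.real, Measure.real, hodd, heven,
    ENNReal.toReal_ofReal (by positivity), ENNReal.toReal_ofReal (by positivity),
    finrank_euclideanSpace_fin]
  push_cast
  field_simp
  linear_combination 2 * 2 ^ l * π ^ (2 * l + 2) * hfactorial

variable {F : EuclideanSpace ℝ (Fin (p + 1)) → X}

theorem integrable_sphericalDirichletKernel_smul (hF : Integrable F) (hR : 0 < R) :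
    Integrable fun y => sphericalDirichletKernel R y • F y := by
  have hcont := continuous_besselIntegral (p + 1)
  simp_rw [sphericalDirichletKernel_eq hR]
  refine hF.bdd_smul (|dirichletConst p| * (R ^ (p + 1) * π))
    (Continuous.aestronglyMeasurable (by fun_prop)) (Eventually.of_forall fun y => ?_)
  rw [norm_mul, norm_mul, Complex.norm_real, norm_pow, Complex.norm_of_nonneg hR.le,
    Real.norm_eq_abs]
  gcongr
  exact norm_besselIntegral_le _ _

theorem integral_Ioi_sphericalDirichletKernel_smul (F : EuclideanSpace ℝ (Fin (p + 1)) → X)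
    (hR : 0 < R) (ω : sphere (0 : EuclideanSpace ℝ (Fin (p + 1))) 1) :
    ∫ r in Set.Ioi (0 : ℝ), r ^ (Module.finrank ℝ (EuclideanSpace ℝ (Fin (p + 1))) - 1) •
        (sphericalDirichletKernel R (r • ω.1) • F (r • ω.1)) =
      dirichletConst p • besselRadialIntegral p R fun r => F (r • ω.1) := by
  rw [besselRadialIntegral, ← integral_smul]
  refine setIntegral_congr_fun measurableSet_Ioi fun r (hr : 0 < r) => ?_
  simp only [sphericalDirichletKernel_eq hR, norm_smul, Real.norm_of_nonneg hr.le,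
    norm_eq_of_mem_sphere, mul_one, finrank_euclideanSpace_fin, add_tsub_cancel_right]
  rw [← Complex.coe_smul, ← Complex.coe_smul, smul_smul, smul_smul]
  congr 1
  push_cast
  ring

theorem integrable_besselRadialIntegral_polar (hF : Integrable F) (hR : 0 < R)
    (x : EuclideanSpace ℝ (Fin (p + 1))) :
    Integrable (fun ω : sphere (0 : EuclideanSpace ℝ (Fin (p + 1))) 1 =>
      dirichletConst p • besselRadialIntegral p R fun r => F (x + r • ω.1))
      (volume : Measure (EuclideanSpace ℝ (Fin (p + 1)))).toSphere := by
  simpa only [integral_Ioi_sphericalDirichletKernel_smul (fun y => F (x + y)) hR] using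
    integrable_integral_polar volume
      (integrable_sphericalDirichletKernel_smul (hF.comp_add_left x) hR)

theorem fourierPartialInversion_eq_integral_besselRadialIntegral [CompleteSpace X]
    (hF : Integrable F) (hR : 0 < R) (x : EuclideanSpace ℝ (Fin (p + 1))) :
    fourierPartialInversion R F x = ∫ ω : sphere (0 : EuclideanSpace ℝ (Fin (p + 1))) 1,
      dirichletConst p • besselRadialIntegral p R (fun r => F (x + r • ω.1))
      ∂(volume : Measure (EuclideanSpace ℝ (Fin (p + 1)))).toSphere := by
  rw [fourierPartialInversion_eq_integral_kernel hF, integral_eq_integral_polar volume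
    (integrable_sphericalDirichletKernel_smul (hF.comp_add_left x) hR)]
  simp only [integral_Ioi_sphericalDirichletKernel_smul (fun y => F (x + y)) hR]

end DirichletKernel

section Majorant

open Metric
open scoped Pointwise

variable {V : Type*} [NormedAddCommGroup V] [NormedSpace ℝ V]
  {E : Type*} [NormedAddCommGroup E] [NormedSpace ℝ E] {F : V → E}

/-- `H` dominates the derivatives of `F` of order at most `l + 1`, in such a way that its polar
density `r^(2l+1) H(rω)` about `x` dominates the jet of `F` along the ray from `x` in any unit
direction `ω`, in the sense of `IsJetDominated`. -/
def IsJetMajorantAt (l : ℕ) (F : V → E) (x : V) (H : V → ℝ) : Prop :=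
  ∀ j ≤ l + 1, ∀ y ≠ 0,
    (1 + ‖y‖) ^ l * ‖iteratedFDeriv ℝ j F (x + y)‖ ≤ ‖y‖ ^ (2 * l + 1) * H y

theorem IsJetMajorantAt.isJetDominated {l : ℕ} {x : V} {H : V → ℝ} (h : IsJetMajorantAt l F x H)
    (hF : ContDiff ℝ (l + 1 : ℕ) F) {w : V} (hw : ‖w‖ = 1)
    (hH : IntegrableOn (fun r : ℝ => r ^ (2 * l + 1) * H (r • w)) (Set.Ioi 0)) :
    IsJetDominated l (fun r : ℝ => F (x + r • w)) fun r => r ^ (2 * l + 1) * H (r • w) where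
  contDiff := by fun_prop
  integrableOn := hH
  le j hj r hr := by
    have hnorm : ‖r • w‖ = r := by rw [norm_smul, hw, mul_one, Real.norm_of_nonneg hr.le]
    have hderiv := norm_iteratedDeriv_comp_add_smul_le hF hj x w r
    rw [hw, one_pow, mul_one] at hderiv
    have hbound := h j hj (r • w) (norm_pos_iff.1 (hr.trans_eq hnorm.symm))
    rw [hnorm] at hbound
    exact (mul_le_mul_of_nonneg_left hderiv (by positivity)).trans hbound

theorem exists_norm_iteratedFDeriv_le_of_isCompact {k : ℕ} (hF : ContDiff ℝ k F) {S : Set V}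
    (hS : IsCompact S) : ∃ B, ∀ j ≤ k, ∀ z ∈ S, ‖iteratedFDeriv ℝ j F z‖ ≤ B := by
  have hbdd : BddAbove (⋃ j ∈ Set.Iic k, (fun z => ‖iteratedFDeriv ℝ j F z‖) '' S) :=
    (Set.finite_Iic k).bddAbove_biUnion.2 fun j hj => hS.bddAbove_image
      (hF.continuous_iteratedFDeriv (mod_cast hj)).norm.continuousOn
  obtain ⟨B, hB⟩ := hbdd
  exact ⟨B, fun j hj z hz => hB (Set.mem_biUnion hj ⟨z, hz, rfl⟩)⟩

variable [FiniteDimensional ℝ V]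

theorem integrableOn_ball_inv_norm_pow [MeasurableSpace V] [BorelSpace V] (μ : Measure V)
    [μ.IsAddHaarMeasure] {p : ℕ} (hp : p < Module.finrank ℝ V) (δ : ℝ) :
    IntegrableOn (fun y => (‖y‖ ^ p)⁻¹) (ball 0 δ) μ := by
  have : Nontrivial V := Module.nontrivial_of_finrank_pos (R := ℝ) (Nat.zero_lt_of_lt hp)
  refine (integrableOn_fun_norm_addHaar μ (f := fun r : ℝ => (r ^ p)⁻¹)).2 ?_
  have hpow : IntegrableOn (fun r : ℝ => r ^ (Module.finrank ℝ V - 1 - p)) (Set.Ioo 0 δ) :=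
    (continuous_pow _).integrableOn_Icc.mono_set Set.Ioo_subset_Icc_self
  refine hpow.congr_fun (fun r hr => ?_) measurableSet_Ioo
  exact pow_sub₀ r hr.1.ne' (by omega)

theorem exists_integrable_isJetMajorantAt [MeasurableSpace V] [BorelSpace V] {μ : Measure V}
    [μ.IsAddHaarMeasure] {l : ℕ} (hl : 2 * l + 1 < Module.finrank ℝ V) {K : Set V}
    (hK : IsCompact K) (hF : ContDiff ℝ (l + 1 : ℕ) F) {g : V → ℝ} (hg : Integrable g μ) {δ : ℝ}
    (hδ : 0 < δ) (hFg : ∀ x ∈ K, ∀ y, δ ≤ ‖y‖ → ∀ j ≤ l + 1,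
      ‖iteratedFDeriv ℝ j F (x + y)‖ ≤ ‖y‖ ^ (l + 1) * g y) :
    ∃ H : V → ℝ, Integrable H μ ∧ ∀ x ∈ K, IsJetMajorantAt l F x H := by
  obtain ⟨B, hB⟩ := exists_norm_iteratedFDeriv_le_of_isCompact hF
    (hK.add (isCompact_closedBall (0 : V) δ))
  let near : V → ℝ := (ball 0 δ).indicator fun y => (1 + δ) ^ l * B * (‖y‖ ^ (2 * l + 1))⁻¹
  let far : V → ℝ := (ball 0 δ)ᶜ.indicator fun y => (1 + δ⁻¹) ^ l * g y
  have hnear : IntegrableOn (fun y => (1 + δ) ^ l * B * (‖y‖ ^ (2 * l + 1))⁻¹) (ball 0 δ) μ :=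
    (integrableOn_ball_inv_norm_pow μ hl δ).const_mul _
  refine ⟨near + far, (hnear.integrable_indicator measurableSet_ball).add
    ((hg.const_mul _).indicator measurableSet_ball.compl), fun x hx j hj y hy => ?_⟩
  rcases lt_or_ge ‖y‖ δ with hyδ | hyδ
  · have hmem : y ∈ ball 0 δ := mem_ball_zero_iff.2 hyδ
    have hFB := hB j hj (x + y) (Set.add_mem_add hx (ball_subset_closedBall hmem))
    calc (1 + ‖y‖) ^ l * ‖iteratedFDeriv ℝ j F (x + y)‖ ≤ (1 + δ) ^ l * B := by gcongr
      _ = ‖y‖ ^ (2 * l + 1) * (near + far) y := by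
        simp only [near, far, Pi.add_apply, Set.indicator_of_mem hmem,
          Set.indicator_of_notMem (Set.notMem_compl_iff.2 hmem), add_zero]
        field_simp
  · have hmem : y ∈ (ball (0 : V) δ)ᶜ := by simpa using hyδ
    have hweight : 1 + ‖y‖ ≤ (1 + δ⁻¹) * ‖y‖ := by
      have : 1 ≤ δ⁻¹ * ‖y‖ := (one_le_inv_mul₀ hδ).2 hyδ
      linarith
    calc (1 + ‖y‖) ^ l * ‖iteratedFDeriv ℝ j F (x + y)‖
        ≤ ((1 + δ⁻¹) * ‖y‖) ^ l * (‖y‖ ^ (l + 1) * g y) := by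
          gcongr
          exact hFg x hx y hyδ j hj
      _ = ‖y‖ ^ (2 * l + 1) * (near + far) y := by
        simp only [near, far, Pi.add_apply, Set.indicator_of_mem hmem,
          Set.indicator_of_notMem hmem, zero_add, mul_pow]
        ring

end Majorant

section Convergence

open Metric

theorem tendsto_integral_norm_besselIntegral_mul (p : ℕ) {V : Type*} [NormedAddCommGroup V]
    [MeasurableSpace V] [OpensMeasurableSpace V] {μ : Measure V} [NullSingletonClass μ] {H : V → ℝ}
    (hH : Integrable H μ) :
    Tendsto (fun R : ℝ => ∫ y, ‖besselIntegral p (R * ‖y‖)‖ * H y ∂μ) atTop (𝓝 0) := by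
  have hcont := continuous_besselIntegral p
  have hlim : ∀ᵐ y ∂μ, Tendsto (fun R : ℝ => ‖besselIntegral p (R * ‖y‖)‖ * H y) atTop (𝓝 0) := by
    filter_upwards [Measure.ae_ne μ (0 : V)] with y hy
    simpa using ((tendsto_besselIntegral_atTop p).comp
      (tendsto_id.atTop_mul_const (norm_pos_iff.2 hy))).norm.mul_const (H y)
  simpa using tendsto_integral_filter_of_dominated_convergence (fun y => π * ‖H y‖)
    (Eventually.of_forall fun R => (Continuous.aestronglyMeasurable (by fun_prop)).mul hH.1)
    (Eventually.of_forall fun R => Eventually.of_forall fun y => by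
      rw [Pi.mul_apply, norm_mul, norm_norm]
      gcongr
      exact norm_besselIntegral_le _ _)
    (hH.norm.const_mul π) hlim

variable {X : Type*} [NormedAddCommGroup X] [NormedSpace ℂ X] [CompleteSpace X] {l : ℕ}
  {F : EuclideanSpace ℝ (Fin (2 * l + 1 + 1)) → X} {H : EuclideanSpace ℝ (Fin (2 * l + 1 + 1)) → ℝ}

theorem fourierPartialInversion_sub_eq_integral_polar (hF : Integrable F) {R : ℝ} (hR : 0 < R)
    (x : EuclideanSpace ℝ (Fin (2 * l + 1 + 1))) :
    fourierPartialInversion R F x - F x =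
      ∫ ω : sphere (0 : EuclideanSpace ℝ (Fin (2 * l + 1 + 1))) 1,
        dirichletConst (2 * l + 1) •
          (besselRadialIntegral (2 * l + 1) R (fun r => F (x + r • ω.1)) -
            (π * (2 * l + 1).factorial) • F x)
        ∂(volume : Measure (EuclideanSpace ℝ (Fin (2 * l + 1 + 1)))).toSphere := by
  simp_rw [smul_sub]
  rw [integral_sub (integrable_besselRadialIntegral_polar hF hR x) (integrable_const _),
    ← fourierPartialInversion_eq_integral_besselRadialIntegral hF hR, integral_const, smul_smul,
    smul_smul, mul_comm (Measure.real _ _), mul_right_comm, dirichletConst_mul_toSphere_univ,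
    one_smul]

theorem norm_fourierPartialInversion_sub_le (hF : Integrable F) (hFl : ContDiff ℝ (l + 1 : ℕ) F)
    (hH : Integrable H) {x : EuclideanSpace ℝ (Fin (2 * l + 1 + 1))}
    (hFH : IsJetMajorantAt l F x H) {R : ℝ} (hR : 0 < R) :
    ‖fourierPartialInversion R F x - F x‖ ≤ dirichletConst (2 * l + 1) * radialErrorConst l *
      ∫ y, ‖besselIntegral 0 (R * ‖y‖)‖ * H y := by
  have hcont := continuous_besselIntegral 0
  have hPH : Integrable fun y => ‖besselIntegral 0 (R * ‖y‖)‖ * H y :=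
    hH.bdd_mul (c := π) (Continuous.aestronglyMeasurable (by fun_prop))
      (Eventually.of_forall fun y => (norm_norm _).trans_le (norm_besselIntegral_le _ _))
  have hconst : 0 ≤ dirichletConst (2 * l + 1) := by unfold dirichletConst; positivity
  rw [fourierPartialInversion_sub_eq_integral_polar hF hR, integral_eq_integral_polar volume hPH,
    ← integral_const_mul]
  refine norm_integral_le_of_norm_le ((integrable_integral_polar volume hPH).const_mul _) ?_
  filter_upwards [ae_integrableOn_polar volume hH] with ω hω
  simp only [finrank_euclideanSpace_fin, add_tsub_cancel_right, smul_eq_mul] at hω ⊢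
  have hdom := hFH.isJetDominated hFl (norm_eq_of_mem_sphere ω) hω
  have hray := hdom.norm_besselRadialIntegral_sub_le hR
  rw [zero_smul, add_zero] at hray
  rw [norm_smul, Real.norm_of_nonneg hconst, mul_assoc]
  refine mul_le_mul_of_nonneg_left (hray.trans_eq ?_) hconst
  congr 1
  refine setIntegral_congr_fun measurableSet_Ioi fun r (hr : 0 < r) => ?_
  simp only [norm_smul, norm_eq_of_mem_sphere, mul_one, Real.norm_of_nonneg hr.le]
  ring

theorem tendstoUniformlyOn_fourierPartialInversion (hF : Integrable F)
    (hFl : ContDiff ℝ (l + 1 : ℕ) F) (hH : Integrable H)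
    {K : Set (EuclideanSpace ℝ (Fin (2 * l + 1 + 1)))} (hFH : ∀ x ∈ K, IsJetMajorantAt l F x H) :
    TendstoUniformlyOn (fun R : ℝ => fourierPartialInversion R F) F atTop K := by
  have hlim := (tendsto_integral_norm_besselIntegral_mul 0 hH).const_mul
    (dirichletConst (2 * l + 1) * radialErrorConst l)
  rw [mul_zero] at hlim
  refine Metric.tendstoUniformlyOn_iff.2 fun ε hε => ?_
  filter_upwards [hlim.eventually_lt_const hε, eventually_gt_atTop 0] with R hRε hR x hx
  rw [dist_comm, dist_eq_norm]
  exact (norm_fourierPartialInversion_sub_le hF hFl hH (hFH x hx) hR).trans_lt hRε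

end Convergence

theorem mainTheorem5 {X : Type*} [NormedAddCommGroup X] [NormedSpace ℂ X] [CompleteSpace X]
    {n k : ℕ} (hk : 1 ≤ k) (hn : n = 2 * k)
    {K : Set (EuclideanSpace ℝ (Fin n))} (hK : IsCompact K)
    {F : EuclideanSpace ℝ (Fin n) → X} (hF : Integrable F) (hFk : ContDiff ℝ (k : ℕ∞) F)
    (hg : ∃ (g : EuclideanSpace ℝ (Fin n) → ℝ) (δ : ℝ), Integrable g ∧ 0 < δ ∧
      ∀ y : EuclideanSpace ℝ (Fin n), δ ≤ ‖y‖ →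
        ∀ α : Fin n → ℕ, ∑ i, α i ≤ k → ∀ x ∈ K,
          ‖y‖ ^ (-(n : ℤ) + (k : ℤ)) * ‖multiPartialDeriv α F (x + y)‖ ≤ g y) :
    TendstoUniformlyOn (fun (R : ℝ) (x : EuclideanSpace ℝ (Fin n)) =>
      fourierPartialInversion R F x) F atTop K := by
  obtain ⟨g, δ, hg, hδ, hFg⟩ := hg
  obtain ⟨l, rfl⟩ : ∃ l, k = l + 1 := ⟨k - 1, by omega⟩
  obtain rfl : n = 2 * l + 1 + 1 := by omega
  have hpartial : ∀ x ∈ K, ∀ y : EuclideanSpace ℝ (Fin (2 * l + 1 + 1)), δ ≤ ‖y‖ →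
      ∀ α : Fin (2 * l + 1 + 1) → ℕ, ∑ i, α i ≤ l + 1 →
        ‖multiPartialDeriv α F (x + y)‖ ≤ ‖y‖ ^ (l + 1) * g y := by
    intro x hx y hy α hα
    have h := hFg y hy α hα x hx
    have hexp : -((2 * l + 1 + 1 : ℕ) : ℤ) + ((l + 1 : ℕ) : ℤ) = -((l + 1 : ℕ) : ℤ) := by
      push_cast
      ring
    rwa [hexp, zpow_neg, zpow_natCast, inv_mul_le_iff₀ (pow_pos (hδ.trans_le hy) _)] at h
  obtain ⟨H, hH, hFH⟩ := exists_integrable_isJetMajorantAt (l := l) (by simp) hK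
    (mod_cast hFk) (hg.const_mul ((2 * l + 1 + 1 : ℕ) ^ (l + 1))) hδ fun x hx y hy j hj => by
      rw [mul_left_comm]
      exact norm_iteratedFDeriv_le_of_multiPartialDeriv_le (mod_cast hFk) hj (hpartial x hx y hy)
  exact tendstoUniformlyOn_fourierPartialInversion hF (mod_cast hFk) hH hFH
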